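/- Let $\mathbf{Top}$ be the category of topological spaces and continuous maps. Consider the following three monads on $\mathbf{Top}$. - The hyperspace monad $(H,\sigma,\mathcal U)$: $HX$ is the set of all closed subsets of $X$ (including $\varnothing$) with the lower Vietoris topology, generated by the sets $\{C : C\cap U\neq\varnothing\}$ for $U\subseteq X$ open; $Hf(C)=\overline{f(C)}$, $\sigma(x)=\overline{\{x\}}$ and $\mathcal U(\mathcal C)=\overline{\bigcup\mathcal C}$. - The valuation monad $(V,\delta,\mathcal E)$: $VX$ is the set of continuous valuations on $X$, i.e. maps $\nu:\mathcal O(X)\to[0,\infty]$ on the lattice of open sets that are strict ($\nu(\varnothing)=0$), monotone, modular ($\nu(U\cup W)+\nu(U\cap W)=\nu(U)+\nu(W)$) and Scott-continuous (preserve directed suprema), with the topology generated by the sets $\{\nu:\nu(U)>r\}$ for $U\subseteq X$ open and $r\in[0,\infty)$; $Vf(\nu)(U)=\nu(f^{-1}(U))$, $\delta(x)(U)=1$ if $x\in U$ and $0$ otherwise, and $(\mathcal E\xi)(U)=\int_{VX}\nu(U)\,d\xi(\nu)$, where $\int g\,d\xi$ is the lower integral of a lower semicontinuous function $g$ with values in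 $[0,\infty]$, the supremum of $\sum_i r_i\,\xi(W_i)$ over all finite families of open sets $W_i$ and coefficients $r_i\in[0,\infty]$ with $\sum_i r_i 1_{W_i}\le g$. - The probability monad $(P,\delta,\mathrm E)$: $PX$ is the set of $\tau$-smooth Borel probability measures on $X$ (those with $p(\bigcup_\lambda U_\lambda)=\sup_\lambda p(U_\lambda)$ for every directed family of open sets), with the topology generated by the sets $\{p:p(U)>r\}$ for $U\subseteq X$ open and $r\in[0,\infty)$, pushforward of measures, Dirac measures as unit, and multiplication $(\mathrm E\mu)(A)=\int_{PX} p(A)\,d\mu(p)$ for Borel sets $A$. For $\nu\in VX$ let $\mathrm{supp}(\nu)$ be the complement of the largest open set $U$ with $\nu(U)=0$; equivalently, $\mathrm{supp}(\nu)$ is the closed set that meets an open set $U$ if and only if $\nu(U)>0$. Let $\iota:PX\to VX$ be the restriction of measures to open sets. Then $\mathrm{supp}:V\to H$ and $\iota:P\to V$ are morphisms of monads, and for every $H$-algebra $(A,a)$ the pair $(A,a\circ\mathrm{supp})$ is a $V$-algebra, and hence $(A,a\circ\mathrm{supp}\circ\iota)$ is a $P$-algebra. Concretely, let $L$ be a topological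 complete join-semilattice, i.e. a complete lattice with a sober topology whose specialization preorder ($x\le y$ if and only if $x\in\overline{\{y\}}$) is the lattice order and for which the binary join $\vee:L\times L\to L$ is continuous. Then the map $VL\to L$, $\nu\mapsto\bigvee\mathrm{supp}(\nu)$, is continuous and is the structure map of a $V$-algebra on $L$. -/

import Mathlib

set_option linter.style.haveILetI false
set_option linter.unnecessarySimpa false

open CategoryTheory TopologicalSpace MeasureTheory Set
open scoped ENNReal

universe u

namespace HypVal

/-! ### The hyperspace monad -/

/-- The hyperspace of `X`: the closed subsets of `X`, including the empty set. -/
structure Hyp (X : Type u) [TopologicalSpace X] : Type u where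
  carrier : Set X
  closed : IsClosed carrier

namespace Hyp

variable {X : Type u} [TopologicalSpace X] {Y : Type u} [TopologicalSpace Y]

/-- `C` hits `U`. -/
def Hits (C : Hyp X) (U : Opens X) : Prop := (C.carrier ∩ (U : Set X)).Nonempty

/-- The set of closed sets that hit the open set `U`. -/
def hit (U : Opens X) : Set (Hyp X) := {C | C.Hits U}

/-- The lower Vietoris topology. -/
instance : TopologicalSpace (Hyp X) := generateFrom (Set.range hit)

/-- The closure of an arbitrary subset, as a point of the hyperspace. -/
def cl (S : Set X) : Hyp X := ⟨closure S, isClosed_closure⟩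

theorem hits_cl (S : Set X) (U : Opens X) :
    (cl S).Hits U ↔ (S ∩ (U : Set X)).Nonempty :=
  closure_inter_open_nonempty_iff U.isOpen

theorem ext_hits {C D : Hyp X} (h : ∀ U : Opens X, C.Hits U ↔ D.Hits U) : C = D := by
  have key : ∀ C D : Hyp X, (∀ U : Opens X, C.Hits U ↔ D.Hits U) →
      C.carrier ⊆ D.carrier := by
    intro C D h x hx
    by_contra hxD
    obtain ⟨y, hy, hy'⟩ := (h ⟨D.carrierᶜ, D.closed.isOpen_compl⟩).1 ⟨x, hx, hxD⟩
    exact hy' hy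
  have := (key C D h).antisymm (key D C fun U => (h U).symm)
  cases C; cases D; simp_all

theorem isOpen_hit (U : Opens X) : IsOpen (hit U) := isOpen_generateFrom_of_mem ⟨U, rfl⟩

/-- `hit U` as an open subset of the hyperspace. -/
def hitOpen (U : Opens X) : Opens (Hyp X) := ⟨hit U, isOpen_hit U⟩

theorem continuous_of_hits {f : Y → Hyp X} (h : ∀ U : Opens X, IsOpen {y | (f y).Hits U}) :
    Continuous f := by
  refine continuous_generateFrom_iff.2 ?_
  rintro _ ⟨U, rfl⟩
  exact h U

/-- The direct image `C ↦ cl (f C)`. -/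
def map (f : C(X, Y)) : C(Hyp X, Hyp Y) where
  toFun C := cl (f '' C.carrier)
  continuous_toFun := by
    refine continuous_of_hits fun U => ?_
    have : {C : Hyp X | (cl (f '' C.carrier)).Hits U} = hit (U.comap f) := by
      ext C
      refine (hits_cl _ _).trans ?_
      constructor
      · rintro ⟨_, ⟨x, hx, rfl⟩, h⟩; exact ⟨x, hx, h⟩
      · rintro ⟨x, hx, h⟩; exact ⟨_, ⟨x, hx, rfl⟩, h⟩
    rw [this]; exact isOpen_hit _

theorem hits_map (f : C(X, Y)) (C : Hyp X) (U : Opens Y) :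
    (map f C).Hits U ↔ C.Hits (U.comap f) := by
  change (cl _).Hits U ↔ _
  rw [hits_cl]
  constructor
  · rintro ⟨_, ⟨x, hx, rfl⟩, h⟩; exact ⟨x, hx, h⟩
  · rintro ⟨x, hx, h⟩; exact ⟨_, ⟨x, hx, rfl⟩, h⟩

/-- The unit `x ↦ cl {x}`. -/
def unit : C(X, Hyp X) where
  toFun x := cl {x}
  continuous_toFun := by
    refine continuous_of_hits fun U => ?_
    have : {x : X | (cl {x}).Hits U} = U := by
      ext x; simp [hits_cl]
    rw [this]; exact U.isOpen

theorem hits_unit (x : X) (U : Opens X) : (unit x).Hits U ↔ x ∈ U := by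
  change (cl {x}).Hits U ↔ _
  simp [hits_cl]

/-- The multiplication `𝒞 ↦ cl (⋃ 𝒞)`. -/
def mult : C(Hyp (Hyp X), Hyp X) where
  toFun K := cl (⋃ C ∈ K.carrier, C.carrier)
  continuous_toFun := by
    refine continuous_of_hits fun U => ?_
    have : {K : Hyp (Hyp X) | (cl (⋃ C ∈ K.carrier, C.carrier)).Hits U} = hit (hitOpen U) := by
      ext K
      refine (hits_cl _ _).trans ?_
      constructor
      · rintro ⟨x, hx, hU⟩
        obtain ⟨C, hC, hx⟩ := mem_iUnion₂.1 hx
        exact ⟨C, hC, x, hx, hU⟩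
      · rintro ⟨C, hC, x, hx, hU⟩
        exact ⟨x, mem_iUnion₂.2 ⟨C, hC, hx⟩, hU⟩
    rw [this]; exact isOpen_hit _

theorem hits_mult (K : Hyp (Hyp X)) (U : Opens X) :
    (mult K).Hits U ↔ K.Hits (hitOpen U) := by
  change (cl _).Hits U ↔ _
  rw [hits_cl]
  constructor
  · rintro ⟨x, hx, hU⟩
    obtain ⟨C, hC, hx⟩ := mem_iUnion₂.1 hx
    exact ⟨C, hC, x, hx, hU⟩
  · rintro ⟨C, hC, x, hx, hU⟩
    exact ⟨x, mem_iUnion₂.2 ⟨C, hC, hx⟩, hU⟩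

variable {Z : Type u} [TopologicalSpace Z]

theorem map_id (C : Hyp X) : map (ContinuousMap.id X) C = C :=
  ext_hits fun U => hits_map _ C U

theorem map_comp (f : C(X, Y)) (g : C(Y, Z)) (C : Hyp X) :
    map (g.comp f) C = map g (map f C) :=
  ext_hits fun U => by rw [hits_map, hits_map, hits_map]; rfl

theorem map_unit (f : C(X, Y)) (x : X) : unit (f x) = map f (unit x) :=
  ext_hits fun U => by rw [hits_map, hits_unit, hits_unit]; rfl

theorem map_mult (f : C(X, Y)) (K : Hyp (Hyp X)) :
    mult (map (map f) K) = map f (mult K) :=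
  ext_hits fun U => by
    have : (hitOpen U).comap (map f) = hitOpen (U.comap f) :=
      Opens.ext <| Set.ext fun C => hits_map f C U
    rw [hits_mult, hits_map, hits_map, hits_mult, this]

theorem mult_assoc (K : Hyp (Hyp (Hyp X))) : mult (map mult K) = mult (mult K) :=
  ext_hits fun U => by
    have : (hitOpen U).comap mult = hitOpen (hitOpen U) :=
      Opens.ext <| Set.ext fun C => hits_mult C U
    rw [hits_mult, hits_map, hits_mult, hits_mult, this]

theorem mult_unit (C : Hyp X) : mult (unit C) = C :=
  ext_hits fun U => by rw [hits_mult, hits_unit]; rfl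

theorem mult_map_unit (C : Hyp X) : mult (map unit C) = C :=
  ext_hits fun U => by
    have : (hitOpen U).comap unit = U := Opens.ext <| Set.ext fun x => hits_unit x U
    rw [hits_mult, hits_map, this]

end Hyp

/-- The hyperspace monad `H` on topological spaces. -/
def hyperspaceMonad : Monad TopCat.{u} where
  obj X := TopCat.of (Hyp X)
  map f := TopCat.ofHom (Hyp.map f.hom)
  map_id _ := TopCat.hom_ext <| ContinuousMap.ext Hyp.map_id
  map_comp f g := TopCat.hom_ext <| ContinuousMap.ext <| Hyp.map_comp f.hom g.hom
  η :=
    { app := fun _ => TopCat.ofHom Hyp.unit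
      naturality := fun _ _ f => TopCat.hom_ext <| ContinuousMap.ext <| Hyp.map_unit f.hom }
  μ :=
    { app := fun _ => TopCat.ofHom Hyp.mult
      naturality := fun _ _ f => TopCat.hom_ext <| ContinuousMap.ext <| Hyp.map_mult f.hom }
  assoc _ := TopCat.hom_ext <| ContinuousMap.ext Hyp.mult_assoc
  left_unit _ := TopCat.hom_ext <| ContinuousMap.ext Hyp.mult_unit
  right_unit _ := TopCat.hom_ext <| ContinuousMap.ext Hyp.mult_map_unit

/-! ### Continuous valuations and their integrals -/

/-- A continuous valuation on `X`. -/
@[ext]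
structure Val (X : Type u) [TopologicalSpace X] : Type u where
  toFun : Opens X → ℝ≥0∞
  map_bot : toFun ⊥ = 0
  mono : ∀ U V : Opens X, U ≤ V → toFun U ≤ toFun V
  modular : ∀ U V : Opens X, toFun (U ⊔ V) + toFun (U ⊓ V) = toFun U + toFun V
  scott : ∀ S : Set (Opens X), S.Nonempty → DirectedOn (· ≤ ·) S →
    toFun (sSup S) = ⨆ U ∈ S, toFun U

namespace Val

variable {X : Type u} [TopologicalSpace X] {Y : Type u} [TopologicalSpace Y]

instance : CoeFun (Val X) fun _ => Opens X → ℝ≥0∞ := ⟨toFun⟩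

/-- The topology of `V X`, generated by the sets `{ν | r < ν U}` for `r ∈ [0, ∞)`. -/
instance : TopologicalSpace (Val X) :=
  generateFrom {S | ∃ (U : Opens X) (r : NNReal), S = {ν : Val X | (r : ℝ≥0∞) < ν U}}

/-- The function `∑ i, r i • 1_{U i}` given by a list of coefficients and open sets. -/
noncomputable def simpleFun (s : List (ℝ≥0∞ × Opens X)) (x : X) : ℝ≥0∞ :=
  (s.map fun p => p.1 * (p.2 : Set X).indicator 1 x).sum

/-- The lower integral of `g` against `ν`: the supremum of the sums `∑ i, r i * ν (U i)` over all
simple lower semicontinuous functions `∑ i, r i • 1_{U i}` below `g`. -/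
noncomputable def integral (ν : Val X) (g : X → ℝ≥0∞) : ℝ≥0∞ :=
  ⨆ (s : List (ℝ≥0∞ × Opens X)) (_ : ∀ x, simpleFun s x ≤ g x),
    (s.map fun p => p.1 * ν p.2).sum

theorem integral_mono (ν : Val X) {f g : X → ℝ≥0∞} (h : ∀ x, f x ≤ g x) :
    ν.integral f ≤ ν.integral g :=
  iSup_mono fun _ => iSup_mono' fun hs => ⟨fun x => (hs x).trans (h x), le_rfl⟩

/-! #### Counting functions of lists of open sets -/

/-- The number of members of the list that contain `x`. -/
noncomputable def cnt (s : List (Opens X)) (x : X) : ℕ :=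
  (s.map fun U => (U : Set X).indicator 1 x).sum

/-- The sum of the values of a valuation on a list of open sets. -/
def mass (ν : Val X) (s : List (Opens X)) : ℝ≥0∞ := (s.map ν).sum

/-- Insert an open set into a decreasing list, keeping the counting function. -/
def ins (U : Opens X) : List (Opens X) → List (Opens X)
  | [] => [U]
  | W :: s => (W ⊔ U) :: ins (W ⊓ U) s

theorem cnt_cons (U : Opens X) (s : List (Opens X)) (x : X) :
    cnt (U :: s) x = (U : Set X).indicator 1 x + cnt s x := by simp [cnt]

theorem mass_cons (ν : Val X) (U : Opens X) (s : List (Opens X)) :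
    ν.mass (U :: s) = ν U + ν.mass s := by simp [mass]

theorem cnt_ins (U : Opens X) (s : List (Opens X)) (x : X) :
    cnt (ins U s) x = (U : Set X).indicator 1 x + cnt s x := by
  induction s generalizing U with
  | nil => simp [ins, cnt]
  | cons W s ih =>
    rw [ins, cnt_cons, ih, cnt_cons]
    by_cases h1 : x ∈ W <;> by_cases h2 : x ∈ U <;> simp [Set.indicator, h1, h2]

theorem mass_ins (ν : Val X) (U : Opens X) (s : List (Opens X)) :
    ν.mass (ins U s) = ν U + ν.mass s := by
  induction s generalizing U with
  | nil => simp [ins, mass]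
  | cons W s ih =>
    rw [ins, mass_cons, ih, mass_cons, ← add_assoc, ν.modular, ← add_assoc, add_comm (ν W)]

theorem ins_le (U W : Opens X) (s : List (Opens X)) (hU : U ≤ W) (hs : ∀ V ∈ s, V ≤ W) :
    ∀ V ∈ ins U s, V ≤ W := by
  induction s generalizing U with
  | nil => simpa [ins] using hU
  | cons W' s ih =>
    intro V hV
    rcases List.mem_cons.1 hV with rfl | hV
    · exact sup_le (hs _ (by simp)) hU
    · exact ih _ (inf_le_right.trans hU) (fun V hV => hs V (by simp [hV])) V hV

theorem ins_sorted (U : Opens X) (s : List (Opens X)) (hs : s.Pairwise (· ≥ ·)) :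
    (ins U s).Pairwise (· ≥ ·) := by
  induction s generalizing U with
  | nil => simp [ins]
  | cons W s ih =>
    rw [List.pairwise_cons] at hs
    rw [ins, List.pairwise_cons]
    refine ⟨ins_le _ _ _ (inf_le_left.trans le_sup_left)
      (fun V hV => (hs.1 V hV).trans le_sup_left), ih _ hs.2⟩

/-- A decreasing list with the same counting function and the same mass. -/
theorem exists_sorted (s : List (Opens X)) : ∃ t : List (Opens X), t.Pairwise (· ≥ ·) ∧
    (∀ x, cnt t x = cnt s x) ∧ ∀ ν : Val X, ν.mass t = ν.mass s := by
  induction s with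
  | nil => exact ⟨[], by simp, fun _ => rfl, fun _ => rfl⟩
  | cons U s ih =>
    obtain ⟨t, h1, h2, h3⟩ := ih
    exact ⟨ins U t, ins_sorted U t h1, fun x => by rw [cnt_ins, cnt_cons, h2],
      fun ν => by rw [mass_ins, mass_cons, h3]⟩

theorem cnt_eq_zero {s : List (Opens X)} {x : X} (h : ∀ U ∈ s, x ∉ U) : cnt s x = 0 := by
  induction s with
  | nil => rfl
  | cons U s ih =>
    rw [cnt_cons, ih fun V hV => h V (by simp [hV])]
    simpa using h U

theorem mass_le_of_sorted (ν : Val X) (s t : List (Opens X)) (hs : s.Pairwise (· ≥ ·))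
    (ht : t.Pairwise (· ≥ ·)) (h : ∀ x, cnt s x ≤ cnt t x) : ν.mass s ≤ ν.mass t := by
  induction s generalizing t with
  | nil => simp [mass]
  | cons W s ih =>
    rw [List.pairwise_cons] at hs
    have h0 : ∀ x ∉ W, cnt s x = 0 := fun x hx => cnt_eq_zero fun U hU hxU => hx (hs.1 U hU hxU)
    cases t with
    | nil =>
      have hW : W = ⊥ := by
        ext x
        have := h x
        rw [cnt_cons] at this
        by_contra hx
        simp at hx
        simp [cnt, hx] at this
      have := ih [] hs.2 (by simp) (fun x => by rw [h0 x (by simp [hW])]; simp)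
      rw [mass_cons, hW, ν.map_bot, zero_add]; exact this
    | cons V t =>
      rw [List.pairwise_cons] at ht
      have h1 : ∀ x ∉ V, cnt t x = 0 := fun x hx => cnt_eq_zero fun U hU hxU => hx (ht.1 U hU hxU)
      have hWV : W ≤ V := by
        intro x hx
        by_contra hxV
        have := h x
        rw [cnt_cons, cnt_cons, h1 x hxV] at this
        have hx' : x ∈ (W : Set X) := hx
        have hxV' : x ∉ (V : Set X) := hxV
        simp [hx', hxV'] at this
      rw [mass_cons, mass_cons]
      refine add_le_add (ν.mono _ _ hWV) (ih t hs.2 ht.2 fun x => ?_)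
      by_cases hx : x ∈ W
      · have := h x
        rw [cnt_cons, cnt_cons] at this
        have hx' : x ∈ (W : Set X) := hx
        have hxV' : x ∈ (V : Set X) := hWV hx
        simpa [hx', hxV'] using this
      · rw [h0 x hx]; simp

theorem mass_le (ν : Val X) (s t : List (Opens X)) (h : ∀ x, cnt s x ≤ cnt t x) :
    ν.mass s ≤ ν.mass t := by
  obtain ⟨s', hs1, hs2, hs3⟩ := exists_sorted s
  obtain ⟨t', ht1, ht2, ht3⟩ := exists_sorted t
  rw [← hs3, ← ht3]
  exact ν.mass_le_of_sorted _ _ hs1 ht1 fun x => by rw [hs2, ht2]; exact h x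

/-- `n` copies of the list `s`. -/
def rep (n : ℕ) (s : List (Opens X)) : List (Opens X) := (List.replicate n s).flatten

theorem cnt_append (s t : List (Opens X)) (x : X) : cnt (s ++ t) x = cnt s x + cnt t x := by
  simp [cnt]

theorem mass_append (ν : Val X) (s t : List (Opens X)) : ν.mass (s ++ t) = ν.mass s + ν.mass t := by
  simp [mass]

theorem cnt_rep (n : ℕ) (s : List (Opens X)) (x : X) : cnt (rep n s) x = n * cnt s x := by
  induction n with
  | zero => simp [rep, cnt]
  | succ n ih =>
    have : rep (n + 1) s = s ++ rep n s := by simp [rep, List.replicate_succ]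
    rw [this, cnt_append, ih]; ring

theorem mass_rep (ν : Val X) (n : ℕ) (s : List (Opens X)) : ν.mass (rep n s) = n * ν.mass s := by
  induction n with
  | zero => simp [rep, mass]
  | succ n ih =>
    have : rep (n + 1) s = s ++ rep n s := by simp [rep, List.replicate_succ]
    rw [this, mass_append, ih]; push_cast; ring

theorem mass_le_mul (ν : Val X) (a b : ℕ) (s t : List (Opens X))
    (h : ∀ x, a * cnt s x ≤ b * cnt t x) : a * ν.mass s ≤ b * ν.mass t := by
  rw [← mass_rep, ← mass_rep]
  exact ν.mass_le _ _ fun x => by rw [cnt_rep, cnt_rep]; exact h x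

/-! #### Dyadic layers -/

/-- The open set `{x | a < g x}` of a lower semicontinuous function `g`. -/
def above (g : X → ℝ≥0∞) (a : ℝ≥0∞) : Opens X := ⟨interior {x | a < g x}, isOpen_interior⟩

theorem mem_above {g : X → ℝ≥0∞} (hg : LowerSemicontinuous g) {a : ℝ≥0∞} {x : X} :
    x ∈ above g a ↔ a < g x := by
  have : interior {x | a < g x} = {x | a < g x} := (hg.isOpen_preimage a).interior_eq
  change x ∈ interior _ ↔ _
  rw [this]; rfl

/-- The first `K` layers of `g` at distance `2⁻ᴹ`. -/
noncomputable def layers (M K : ℕ) (g : X → ℝ≥0∞) : List (Opens X) :=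
  (List.range K).map fun k => above g ((k + 1 : ℕ) / 2 ^ M)

theorem layers_succ (M K : ℕ) (g : X → ℝ≥0∞) :
    layers M (K + 1) g = layers M K g ++ [above g ((K + 1 : ℕ) / 2 ^ M)] := by
  simp [layers, List.range_succ]

theorem cnt_layers_succ (M K : ℕ) (g : X → ℝ≥0∞) (x : X) :
    cnt (layers M (K + 1) g) x = cnt (layers M K g) x +
      ((above g ((K + 1 : ℕ) / 2 ^ M) : Opens X) : Set X).indicator 1 x := by
  rw [layers_succ, cnt_append, cnt_cons]; rfl

theorem cnt_layers_le (M K : ℕ) (g : X → ℝ≥0∞) (x : X) : cnt (layers M K g) x ≤ K := by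
  induction K with
  | zero => simp [layers, cnt]
  | succ K ih =>
    rw [cnt_layers_succ]
    have : ((above g ((K + 1 : ℕ) / 2 ^ M) : Opens X) : Set X).indicator (1 : X → ℕ) x ≤ 1 :=
      Set.indicator_le_self' (by simp) x
    omega

/-- The number of layers above `x` is `0` or `c` with `c * 2⁻ᴹ < g x`. -/
theorem cnt_layers_lt {g : X → ℝ≥0∞} (hg : LowerSemicontinuous g) (M K : ℕ) (x : X) :
    cnt (layers M K g) x = 0 ∨ (cnt (layers M K g) x : ℝ≥0∞) / 2 ^ M < g x := by
  induction K with
  | zero => left; simp [layers, cnt]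
  | succ K ih =>
    rw [cnt_layers_succ]
    by_cases h : x ∈ above g ((K + 1 : ℕ) / 2 ^ M)
    · right
      have h' : x ∈ (above g ((K + 1 : ℕ) / 2 ^ M) : Set X) := h
      rw [Set.indicator_of_mem h']
      refine lt_of_le_of_lt ?_ ((mem_above hg).1 h)
      have := cnt_layers_le M K g x
      gcongr
      simpa using this
    · have h' : x ∉ (above g ((K + 1 : ℕ) / 2 ^ M) : Set X) := h
      rw [Set.indicator_of_notMem h']
      simpa using ih

theorem cnt_layers_div_le {g : X → ℝ≥0∞} (hg : LowerSemicontinuous g) (M K : ℕ) (x : X) :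
    (cnt (layers M K g) x : ℝ≥0∞) / 2 ^ M ≤ g x := by
  rcases cnt_layers_lt hg M K x with h | h
  · simp [h]
  · exact h.le

/-- Conversely there are at least `c` layers above `x` if `c * 2⁻ᴹ < g x` and `c ≤ K`. -/
theorem le_cnt_layers {g : X → ℝ≥0∞} (hg : LowerSemicontinuous g) (M K : ℕ) (x : X) (c : ℕ)
    (hc : c ≤ K) (h : c = 0 ∨ (c : ℝ≥0∞) / 2 ^ M < g x) : c ≤ cnt (layers M K g) x := by
  induction K generalizing c with
  | zero => omega
  | succ K ih =>
    rw [cnt_layers_succ]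
    rcases Nat.lt_or_ge K c with h1 | h1
    · obtain rfl : c = K + 1 := by omega
      rcases h with h | h
      · omega
      have h' : x ∈ (above g ((K + 1 : ℕ) / 2 ^ M) : Set X) := (mem_above hg).2 h
      rw [Set.indicator_of_mem h']
      have := ih K le_rfl (Or.inr (lt_of_le_of_lt (by gcongr) h))
      simpa using this
    · exact (ih c h1 h).trans (Nat.le_add_right _ _)

theorem simpleFun_const (r : ℝ≥0∞) (s : List (Opens X)) (x : X) :
    simpleFun (s.map fun U => (r, U)) x = r * cnt s x := by
  induction s with
  | nil => simp [simpleFun, cnt]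
  | cons U s ih =>
    rw [cnt_cons]
    simp only [simpleFun, List.map_cons, List.sum_cons] at *
    rw [ih]
    by_cases h : x ∈ (U : Set X) <;> simp [h, mul_add]

theorem sum_const (ν : Val X) (r : ℝ≥0∞) (s : List (Opens X)) :
    ((s.map fun U => (r, U)).map fun p => p.1 * ν p.2).sum = r * ν.mass s := by
  induction s with
  | nil => simp [mass]
  | cons U s ih =>
    rw [mass_cons, mul_add, ← ih]; simp

theorem le_integral (ν : Val X) {g : X → ℝ≥0∞} (r : ℝ≥0∞) (s : List (Opens X))
    (h : ∀ x, r * cnt s x ≤ g x) : r * ν.mass s ≤ ν.integral g := by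
  rw [← sum_const]
  exact le_iSup₂_of_le (s.map fun U => (r, U)) (fun x => by rw [simpleFun_const]; exact h x) le_rfl

/-- Numerators of dyadic approximations of `r` from below. -/
noncomputable def num (M : ℕ) (r : ℝ≥0∞) : ℕ :=
  if r ≤ M then ⌈r.toReal * 2 ^ M⌉₊ - 1 else M * 2 ^ M

theorem num_lt (M : ℕ) (r : ℝ≥0∞) : num M r = 0 ∨ (num M r : ℝ≥0∞) / 2 ^ M < r := by
  unfold num
  split_ifs with h
  · rcases Nat.eq_zero_or_pos (⌈r.toReal * 2 ^ M⌉₊ - 1) with h0 | h0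
    · exact Or.inl h0
    right
    have hr : r ≠ ∞ := ne_top_of_le_ne_top (by simp) h
    have h1 : ((⌈r.toReal * 2 ^ M⌉₊ - 1 : ℕ) : ℝ) < r.toReal * 2 ^ M :=
      Nat.lt_ceil.1 (by omega)
    rw [ENNReal.div_lt_iff (by simp) (by simp)]
    have h2 := (ENNReal.ofReal_lt_ofReal_iff_of_nonneg (by positivity)).2 h1
    rwa [ENNReal.ofReal_natCast, ENNReal.ofReal_mul (by positivity), ENNReal.ofReal_toReal hr,
      ENNReal.ofReal_pow (by norm_num), ENNReal.ofReal_ofNat] at h2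
  · right
    push_cast
    rw [ENNReal.mul_div_cancel_right (by simp) (by simp)]
    exact not_le.1 h

theorem num_zero (M : ℕ) : num M 0 = 0 := by simp [num]

open Filter Topology in
theorem tendsto_num (r : ℝ≥0∞) :
    Tendsto (fun M => (num M r : ℝ≥0∞) / 2 ^ M) atTop (𝓝 r) := by
  by_cases hr : r = ∞
  · subst hr
    have : (fun M : ℕ => (num M ∞ : ℝ≥0∞) / 2 ^ M) = fun M : ℕ => (M : ℝ≥0∞) := by
      ext M
      simp only [num, top_le_iff, ENNReal.natCast_ne_top, if_false]
      push_cast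
      rw [ENNReal.mul_div_cancel_right (by simp) (by simp)]
    rw [this]; exact ENNReal.tendsto_nat_nhds_top
  · have hlim : Tendsto (fun M : ℕ => r - (2⁻¹ : ℝ≥0∞) ^ M) atTop (𝓝 r) := by
      have h := ENNReal.Tendsto.sub (tendsto_const_nhds (x := r) (f := atTop (α := ℕ)))
        (ENNReal.tendsto_pow_atTop_nhds_zero_of_lt_one (r := (2⁻¹ : ℝ≥0∞)) (by norm_num))
        (Or.inl hr)
      simpa using h
    refine tendsto_of_tendsto_of_tendsto_of_le_of_le' hlim tendsto_const_nhds ?_ ?_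
    · obtain ⟨n, hn⟩ := ENNReal.exists_nat_gt hr
      filter_upwards [eventually_ge_atTop n] with M hM
      have hrM : r ≤ M := hn.le.trans (by exact_mod_cast hM)
      rw [tsub_le_iff_right, num, if_pos hrM]
      have h1 : r.toReal * 2 ^ M ≤ ((⌈r.toReal * 2 ^ M⌉₊ - 1 : ℕ) : ℝ) + 1 := by
        refine (Nat.le_ceil _).trans ?_
        have : ⌈r.toReal * 2 ^ M⌉₊ ≤ (⌈r.toReal * 2 ^ M⌉₊ - 1) + 1 := by omega
        exact_mod_cast this
      have h2 := ENNReal.ofReal_le_ofReal h1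
      rw [ENNReal.ofReal_mul (by positivity), ENNReal.ofReal_toReal hr,
        ENNReal.ofReal_pow (by norm_num), ENNReal.ofReal_ofNat,
        ENNReal.ofReal_add (by positivity) (by norm_num), ENNReal.ofReal_natCast,
        ENNReal.ofReal_one] at h2
      have h3 : (2⁻¹ : ℝ≥0∞) ^ M = 1 / 2 ^ M := by rw [one_div, ENNReal.inv_pow]
      rw [h3, ← ENNReal.add_div]
      exact (ENNReal.le_div_iff_mul_le (by simp) (by simp)).2 h2
    · filter_upwards with M
      rcases num_lt M r with h | h
      · simp [h]
      · exact h.le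

/-- The list of open sets that approximates a simple function from below. -/
noncomputable def approx (M : ℕ) (s : List (ℝ≥0∞ × Opens X)) : List (Opens X) :=
  s.flatMap fun p => List.replicate (num M p.1) p.2

theorem approx_cons (M : ℕ) (p : ℝ≥0∞ × Opens X) (s : List (ℝ≥0∞ × Opens X)) :
    approx M (p :: s) = rep (num M p.1) [p.2] ++ approx M s := by
  simp [approx, rep]

theorem cnt_approx (M : ℕ) (s : List (ℝ≥0∞ × Opens X)) (x : X) :
    cnt (approx M s) x = 0 ∨ (cnt (approx M s) x : ℝ≥0∞) / 2 ^ M < simpleFun s x := by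
  induction s with
  | nil => left; simp [approx, cnt]
  | cons p s ih =>
    rw [approx_cons, cnt_append, cnt_rep]
    have hs : simpleFun (p :: s) x = p.1 * (p.2 : Set X).indicator 1 x + simpleFun s x := by
      simp [simpleFun]
    rw [hs]
    by_cases hx : x ∈ (p.2 : Set X)
    · have h1 : cnt [p.2] x = 1 := by simp [cnt, hx]
      rw [h1, Set.indicator_of_mem hx]
      simp only [mul_one, Pi.one_apply, Nat.cast_add]
      rw [ENNReal.add_div]
      rcases num_lt M p.1 with h | h <;> rcases ih with h' | h'
      · left; omega
      · right; rw [h]; simpa using h'.trans_le le_add_self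
      · right; rw [h']; simpa using h.trans_le le_self_add
      · right; exact ENNReal.add_lt_add h h'
    · have h1 : cnt [p.2] x = 0 := by simp [cnt, hx]
      rw [h1, Set.indicator_of_notMem hx]
      simpa using ih

theorem mass_approx (ν : Val X) (M : ℕ) (s : List (ℝ≥0∞ × Opens X)) :
    ν.mass (approx M s) / 2 ^ M = (s.map fun p => ((num M p.1 : ℝ≥0∞) / 2 ^ M) * ν p.2).sum := by
  induction s with
  | nil => simp [approx, mass]
  | cons p s ih =>
    rw [approx_cons, mass_append, mass_rep, ENNReal.add_div, ih, List.map_cons, List.sum_cons]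
    congr 1
    simp [mass, div_eq_mul_inv, mul_right_comm]

open Filter Topology in
theorem tendsto_mass_approx (ν : Val X) (s : List (ℝ≥0∞ × Opens X)) :
    Tendsto (fun M => ν.mass (approx M s) / 2 ^ M) atTop
      (𝓝 (s.map fun p => p.1 * ν p.2).sum) := by
  simp_rw [mass_approx]
  induction s with
  | nil => simp
  | cons p s ih =>
    simp only [List.map_cons, List.sum_cons]
    refine Tendsto.add ?_ ih
    by_cases h : p.1 = 0
    · simp [h, num_zero]
    · exact ENNReal.Tendsto.mul_const (tendsto_num p.1) (Or.inl h)

theorem cnt_le_length (s : List (Opens X)) (x : X) : cnt s x ≤ s.length := by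
  induction s with
  | nil => simp [cnt]
  | cons U s ih =>
    rw [cnt_cons, List.length_cons]
    have : (U : Set X).indicator (1 : X → ℕ) x ≤ 1 := Set.indicator_le_self' (by simp) x
    omega

theorem integral_eq_iSup (ν : Val X) {g : X → ℝ≥0∞} (hg : LowerSemicontinuous g) :
    ν.integral g = ⨆ p : ℕ × ℕ, ν.mass (layers p.1 p.2 g) / 2 ^ p.1 := by
  refine le_antisymm (iSup₂_le fun s hs => ?_) (iSup_le fun p => ?_)
  · refine le_of_tendsto' (ν.tendsto_mass_approx s) fun M => ?_
    refine le_iSup_of_le (M, (approx M s).length) ?_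
    gcongr
    refine ν.mass_le _ _ fun x => le_cnt_layers hg _ _ _ _ (cnt_le_length _ _) ?_
    exact (cnt_approx M s x).imp id fun h => h.trans_le (hs x)
  · rw [div_eq_mul_inv, mul_comm]
    refine ν.le_integral _ _ fun x => ?_
    rw [mul_comm, ← div_eq_mul_inv]
    exact cnt_layers_div_le hg _ _ _

/-- The integral commutes with directed suprema. -/
theorem integral_iSup {ι : Type*} [Nonempty ι] (ν : Val X) (g : ι → X → ℝ≥0∞)
    (hg : ∀ i, LowerSemicontinuous (g i)) (hd : Directed (· ≤ ·) g) :
    ν.integral (fun x => ⨆ i, g i x) = ⨆ i, ν.integral (g i) := by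
  refine le_antisymm ?_ (iSup_le fun i => ν.integral_mono fun x => le_iSup (fun i => g i x) i)
  rw [integral_eq_iSup ν (lowerSemicontinuous_iSup hg)]
  refine iSup_le fun p => ?_
  have h1 : ∀ a, above (fun x => ⨆ i, g i x) a = sSup (Set.range fun i => above (g i) a) := by
    intro a
    ext x
    rw [SetLike.mem_coe, mem_above (lowerSemicontinuous_iSup hg), lt_iSup_iff]
    simp [mem_above (hg _)]
  have hmono : ∀ i j a, g i ≤ g j → above (g i) a ≤ above (g j) a := by
    intro i j a h x hx
    rw [mem_above (hg _)] at *
    exact hx.trans_le (h x)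
  have h2 : ∀ a, ν (above (fun x => ⨆ i, g i x) a) = ⨆ i, ν (above (g i) a) := by
    intro a
    rw [h1, ν.scott _ (Set.range_nonempty _), iSup_range]
    rintro _ ⟨i, rfl⟩ _ ⟨j, rfl⟩
    obtain ⟨k, hi, hj⟩ := hd i j
    exact ⟨_, ⟨k, rfl⟩, hmono _ _ _ hi, hmono _ _ _ hj⟩
  have hsum : ∀ f : X → ℝ≥0∞, ν.mass (layers p.1 p.2 f) =
      ∑ k ∈ Finset.range p.2, ν (above f ((k + 1 : ℕ) / 2 ^ p.1)) := by
    intro f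
    generalize p.2 = K
    induction K with
    | zero => simp [layers, mass]
    | succ K ih => rw [layers_succ, mass_append, ih, Finset.sum_range_succ]; simp [mass]
  rw [hsum]
  simp_rw [h2]
  rw [ENNReal.finsetSum_iSup, div_eq_mul_inv, ENNReal.iSup_mul]
  · refine iSup_mono fun i => ?_
    rw [← hsum, ← div_eq_mul_inv, integral_eq_iSup ν (hg i)]
    exact le_iSup (fun p : ℕ × ℕ => ν.mass (layers p.1 p.2 (g i)) / 2 ^ p.1) p
  · intro i j
    obtain ⟨k, hi, hj⟩ := hd i j
    exact ⟨k, fun a => ⟨ν.mono _ _ (hmono _ _ _ hi), ν.mono _ _ (hmono _ _ _ hj)⟩⟩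

theorem lsc_indicator (U : Opens X) :
    LowerSemicontinuous ((U : Set X).indicator (1 : X → ℝ≥0∞)) :=
  U.isOpen.lowerSemicontinuous_indicator zero_le_one

theorem cnt_cast_cons (U : Opens X) (s : List (Opens X)) :
    (fun x => (cnt (U :: s) x : ℝ≥0∞)) =
      (U : Set X).indicator 1 + fun x => (cnt s x : ℝ≥0∞) := by
  ext x
  rw [cnt_cons]
  by_cases h : x ∈ (U : Set X) <;> simp [h]

theorem lsc_cnt (s : List (Opens X)) : LowerSemicontinuous fun x => (cnt s x : ℝ≥0∞) := by
  induction s with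
  | nil => simpa [cnt] using lowerSemicontinuous_const
  | cons U s ih =>
    rw [cnt_cast_cons]
    exact (lsc_indicator U).add ih

theorem lsc_div {g : X → ℝ≥0∞} (hg : LowerSemicontinuous g) (N : ℕ) :
    LowerSemicontinuous fun x => g x / 2 ^ N :=
  (ENNReal.continuous_div_const (2 ^ N) (by simp)).comp_lowerSemicontinuous hg
    fun _ _ h => ENNReal.div_le_div_right h _

theorem integral_cnt (ν : Val X) (N : ℕ) (t : List (Opens X)) :
    ν.integral (fun x => (cnt t x : ℝ≥0∞) / 2 ^ N) = ν.mass t / 2 ^ N := by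
  have hl := lsc_div (lsc_cnt t) N
  refine le_antisymm ?_ ?_
  · rw [integral_eq_iSup ν hl]
    refine iSup_le fun p => ?_
    rw [ENNReal.div_le_iff (by simp) (by simp), div_eq_mul_inv, mul_right_comm, ← div_eq_mul_inv,
      ENNReal.le_div_iff_mul_le (by simp) (by simp), mul_comm, mul_comm (ν.mass t)]
    have := ν.mass_le_mul (2 ^ N) (2 ^ p.1) (layers p.1 p.2 fun x => (cnt t x : ℝ≥0∞) / 2 ^ N) t ?_
    · simpa using this
    intro x
    have h := cnt_layers_div_le hl p.1 p.2 x
    rw [ENNReal.div_le_iff (by simp) (by simp), div_eq_mul_inv, mul_right_comm, ← div_eq_mul_inv,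
      ENNReal.le_div_iff_mul_le (by simp) (by simp), mul_comm, mul_comm (cnt t x : ℝ≥0∞)] at h
    exact_mod_cast h
  · rw [div_eq_mul_inv, mul_comm]
    refine ν.le_integral _ _ fun x => ?_
    rw [mul_comm, ← div_eq_mul_inv]

theorem integral_indicator (ν : Val X) (U : Opens X) :
    ν.integral ((U : Set X).indicator 1) = ν U := by
  have h := ν.integral_cnt 0 [U]
  have h1 : (fun x => (cnt [U] x : ℝ≥0∞) / 2 ^ 0) = (U : Set X).indicator 1 := by
    ext x
    by_cases hx : x ∈ (U : Set X) <;> simp [cnt, hx]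
  rw [h1] at h
  simpa [mass] using h

/-- Dyadic approximations of a function from below. -/
noncomputable def dy (N : ℕ) (g : X → ℝ≥0∞) (x : X) : ℝ≥0∞ :=
  (cnt (layers N (N * 2 ^ N) g) x : ℝ≥0∞) / 2 ^ N

theorem lsc_dy (N : ℕ) (g : X → ℝ≥0∞) : LowerSemicontinuous (dy N g) := lsc_div (lsc_cnt _) N

theorem dy_mono {g : X → ℝ≥0∞} (hg : LowerSemicontinuous g) : Monotone fun N => dy N g := by
  refine monotone_nat_of_le_succ fun N x => ?_
  have key : 2 * cnt (layers N (N * 2 ^ N) g) x ≤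
      cnt (layers (N + 1) ((N + 1) * 2 ^ (N + 1)) g) x := by
    refine le_cnt_layers hg _ _ _ _ ?_ ?_
    · have := cnt_layers_le N (N * 2 ^ N) g x
      rw [pow_succ]
      nlinarith [Nat.zero_le (2 ^ N)]
    · refine (cnt_layers_lt hg N (N * 2 ^ N) x).imp (fun h => by simp [h]) fun h => ?_
      refine lt_of_eq_of_lt ?_ h
      push_cast
      rw [pow_succ', ENNReal.mul_div_mul_left _ _ (by simp) (by simp)]
  unfold dy
  calc (cnt (layers N (N * 2 ^ N) g) x : ℝ≥0∞) / 2 ^ N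
      = ((2 * cnt (layers N (N * 2 ^ N) g) x : ℕ) : ℝ≥0∞) / 2 ^ (N + 1) := by
        push_cast
        rw [pow_succ', ENNReal.mul_div_mul_left _ _ (by simp) (by simp)]
    _ ≤ _ := by gcongr

theorem iSup_dy {g : X → ℝ≥0∞} (hg : LowerSemicontinuous g) : (fun x => ⨆ N, dy N g x) = g := by
  ext x
  refine le_antisymm (iSup_le fun N => cnt_layers_div_le hg _ _ _) ?_
  refine le_of_tendsto' (tendsto_num (g x)) fun M => le_iSup_of_le M ?_
  unfold dy
  gcongr
  refine le_cnt_layers hg _ _ _ _ ?_ (num_lt M (g x))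
  unfold num
  split_ifs with h
  · have hr : g x ≠ ∞ := ne_top_of_le_ne_top (by simp) h
    have h1 : (g x).toReal ≤ M := by
      have := ENNReal.toReal_mono (by simp) h
      simpa using this
    have h2 : ⌈(g x).toReal * 2 ^ M⌉₊ ≤ M * 2 ^ M := by
      refine Nat.ceil_le.2 ?_
      push_cast
      gcongr
    omega
  · exact le_rfl

theorem integral_add (ν : Val X) {f g : X → ℝ≥0∞} (hf : LowerSemicontinuous f)
    (hg : LowerSemicontinuous g) : ν.integral (f + g) = ν.integral f + ν.integral g := by
  have hfm := dy_mono hf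
  have hgm := dy_mono hg
  have hN : ∀ N, ν.integral (dy N f + dy N g) = ν.integral (dy N f) + ν.integral (dy N g) := by
    intro N
    have := ν.integral_cnt N (layers N (N * 2 ^ N) f ++ layers N (N * 2 ^ N) g)
    simp_rw [cnt_append, Nat.cast_add, ENNReal.add_div, mass_append] at this
    rw [ENNReal.add_div, ← integral_cnt, ← integral_cnt] at this
    exact this
  have h1 : f + g = fun x => ⨆ N, (dy N f + dy N g) x := by
    ext x
    have := ENNReal.iSup_add_iSup_of_monotone (f := fun N => dy N f x) (g := fun N => dy N g x)
      (fun _ _ h => hfm h x) (fun _ _ h => hgm h x)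
    simp only [Pi.add_apply]
    rw [← this]
    exact congrArg₂ (· + ·) (congrFun (iSup_dy hf) x).symm (congrFun (iSup_dy hg) x).symm
  have hs : ∀ h : X → ℝ≥0∞, LowerSemicontinuous h →
      ν.integral h = ⨆ N, ν.integral (dy N h) := by
    intro h hh
    conv_lhs => rw [← iSup_dy hh]
    exact ν.integral_iSup _ (fun N => lsc_dy N h) (dy_mono hh).directed_le
  rw [hs f hf, hs g hg, ENNReal.iSup_add_iSup_of_monotone, h1, integral_iSup]
  · exact iSup_congr hN
  · exact fun N => (lsc_dy N f).add (lsc_dy N g)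
  · exact Monotone.directed_le fun _ _ h => add_le_add (hfm h) (hgm h)
  · exact fun _ _ h => ν.integral_mono (hfm h)
  · exact fun _ _ h => ν.integral_mono (hgm h)

/-- An additive functional that commutes with increasing limits and extends a valuation is
integration against it. -/
theorem functional_eq (ν : Val X) (F : (X → ℝ≥0∞) → ℝ≥0∞)
    (hadd : ∀ f g, LowerSemicontinuous f → LowerSemicontinuous g → F (f + g) = F f + F g)
    (hsup : ∀ f : ℕ → X → ℝ≥0∞, Monotone f → (∀ n, LowerSemicontinuous (f n)) →
      F (fun x => ⨆ n, f n x) = ⨆ n, F (f n))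
    (hind : ∀ U : Opens X, F ((U : Set X).indicator 1) = ν U)
    {g : X → ℝ≥0∞} (hg : LowerSemicontinuous g) : F g = ν.integral g := by
  have hcnt : ∀ t : List (Opens X), F (fun x => (cnt t x : ℝ≥0∞)) = ν.mass t := by
    intro t
    induction t with
    | nil =>
      have := hind ⊥
      rw [ν.map_bot] at this
      simpa [cnt, mass, Pi.zero_def] using this
    | cons U t ih =>
      rw [cnt_cast_cons, hadd _ _ (lsc_indicator U) (lsc_cnt t), hind, ih, mass_cons]
  have hmul : ∀ (n : ℕ) (f : X → ℝ≥0∞), LowerSemicontinuous f →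
      F (fun x => (n + 1) * f x) = (n + 1) * F f := by
    intro n f hf
    have hlsc : ∀ n : ℕ, LowerSemicontinuous fun x => (n + 1) * f x := fun n =>
      (ENNReal.continuous_const_mul (by simp)).comp_lowerSemicontinuous hf
        fun _ _ h => mul_le_mul_right h _
    induction n with
    | zero => simp
    | succ n ih =>
      have : (fun x => ((n + 1 : ℕ) + 1) * f x) = (fun x => (n + 1) * f x) + f := by
        ext x; simp [add_mul]
      rw [this, hadd _ _ (hlsc n) hf, ih]
      push_cast; ring
  have hdy : ∀ N, F (dy N g) = ν.integral (dy N g) := by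
    intro N
    have h1 := hmul (2 ^ N - 1) (dy N g) (lsc_dy N g)
    have h2 : ((2 ^ N - 1 : ℕ) : ℝ≥0∞) + 1 = 2 ^ N := by
      have : (2 ^ N - 1) + 1 = 2 ^ N := Nat.sub_add_cancel Nat.one_le_two_pow
      exact_mod_cast this
    have h3 : (fun x => (2 : ℝ≥0∞) ^ N * dy N g x) =
        fun x => (cnt (layers N (N * 2 ^ N) g) x : ℝ≥0∞) := by
      ext x
      exact ENNReal.mul_div_cancel (by simp) (by simp)
    rw [h2, h3, hcnt] at h1
    have h4 : ν.integral (dy N g) = ν.mass (layers N (N * 2 ^ N) g) / 2 ^ N := integral_cnt _ _ _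
    rw [h4, h1, mul_comm, ENNReal.mul_div_cancel_right (by simp) (by simp)]
  conv_lhs => rw [← iSup_dy hg]
  conv_rhs => rw [← iSup_dy hg]
  rw [hsup _ (dy_mono hg) fun N => lsc_dy N g,
    ν.integral_iSup _ (fun N => lsc_dy N g) (dy_mono hg).directed_le]
  exact iSup_congr hdy

/-! #### Lower semicontinuity in the valuation -/

theorem isOpen_lt (U : Opens X) (r : NNReal) : IsOpen {ν : Val X | (r : ℝ≥0∞) < ν U} :=
  isOpen_generateFrom_of_mem ⟨U, r, rfl⟩

theorem lsc_eval (U : Opens X) : LowerSemicontinuous fun ν : Val X => ν U := by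
  refine lowerSemicontinuous_iff_isOpen_preimage.2 fun a => ?_
  by_cases ha : a = ∞
  · subst ha; simp
  · lift a to NNReal using ha
    exact isOpen_lt U a

theorem lsc_mass (s : List (Opens X)) : LowerSemicontinuous fun ν : Val X => ν.mass s := by
  induction s with
  | nil => simpa [mass] using lowerSemicontinuous_const
  | cons U s ih =>
    simp_rw [mass_cons]
    exact (lsc_eval U).add ih

theorem lsc_integral {g : X → ℝ≥0∞} (hg : LowerSemicontinuous g) :
    LowerSemicontinuous fun ν : Val X => ν.integral g := by
  simp_rw [fun ν : Val X => ν.integral_eq_iSup hg]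
  exact lowerSemicontinuous_iSup fun p => lsc_div (lsc_mass _) _

theorem continuous_of_eval {f : Y → Val X} (h : ∀ U : Opens X, LowerSemicontinuous fun y => f y U) :
    Continuous f := by
  refine continuous_generateFrom_iff.2 ?_
  rintro _ ⟨U, r, rfl⟩
  exact (h U).isOpen_preimage r

/-! ### The valuation monad -/

/-- The pushforward `(f_* ν)(U) = ν (f⁻¹ U)`. -/
def map (f : C(X, Y)) : C(Val X, Val Y) where
  toFun ν :=
    { toFun := fun U => ν (U.comap f)
      map_bot := ν.map_bot
      mono := fun _ _ h => ν.mono _ _ fun _ hx => h hx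
      modular := fun U V => ν.modular (U.comap f) (V.comap f)
      scott := fun S hS hd => by
        have h1 : (sSup S).comap f = sSup (Opens.comap f '' S) := by
          ext x; simp
        rw [h1, ν.scott _ (hS.image _), iSup_image]
        rintro _ ⟨U, hU, rfl⟩ _ ⟨V, hV, rfl⟩
        obtain ⟨W, hW, hUW, hVW⟩ := hd U hU V hV
        exact ⟨_, ⟨W, hW, rfl⟩, fun _ hx => hUW hx, fun _ hx => hVW hx⟩ }
  continuous_toFun := continuous_of_eval fun U => lsc_eval (U.comap f)

theorem map_apply (f : C(X, Y)) (ν : Val X) (U : Opens Y) : map f ν U = ν (U.comap f) := rfl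

/-- The Dirac valuation. -/
noncomputable def dirac : C(X, Val X) where
  toFun x :=
    { toFun := fun U => (U : Set X).indicator 1 x
      map_bot := by simp
      mono := fun U V h => Set.indicator_le_indicator_of_subset h (by simp) x
      modular := fun U V => by
        by_cases h1 : x ∈ U <;> by_cases h2 : x ∈ V <;> simp [Set.indicator, h1, h2]
      scott := fun S _ _ => by
        by_cases h : x ∈ sSup S
        · obtain ⟨U, hU, hx⟩ := Opens.mem_sSup.1 h
          refine le_antisymm ?_ (iSup₂_le fun V hV =>
            Set.indicator_le_indicator_of_subset (show V ≤ sSup S from le_sSup hV) (by simp) x)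
          refine le_iSup₂_of_le U hU ?_
          rw [Set.indicator_of_mem (show x ∈ (U : Set X) from hx)]
          exact Set.indicator_le_self' (by simp) x
        · rw [Set.indicator_of_notMem h]
          symm
          simp only [ENNReal.iSup_eq_zero]
          intro U hU
          exact Set.indicator_of_notMem (fun hx => h (Opens.mem_sSup.2 ⟨U, hU, hx⟩)) _ }
  continuous_toFun := continuous_of_eval fun U => lsc_indicator U

theorem dirac_apply (x : X) (U : Opens X) : dirac x U = (U : Set X).indicator 1 x := rfl

/-- The multiplication `(E ξ)(U) = ∫ ν(U) dξ(ν)`. -/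
noncomputable def mult : C(Val (Val X), Val X) where
  toFun ξ :=
    { toFun := fun U => ξ.integral fun ν => ν U
      map_bot := by
        have h := ξ.integral_indicator ⊥
        rw [ξ.map_bot] at h
        rw [← h]
        congr 1
        ext ν
        simp [ν.map_bot]
      mono := fun U V h => ξ.integral_mono fun ν => ν.mono _ _ h
      modular := fun U V => by
        rw [← integral_add _ (lsc_eval _) (lsc_eval _), ← integral_add _ (lsc_eval _) (lsc_eval _)]
        congr 1
        ext ν
        exact ν.modular U V
      scott := fun S hS hd => by
        have : Nonempty S := hS.to_subtype
        have h1 : (fun ν : Val X => ν (sSup S)) = fun ν => ⨆ U : S, ν U.1 := by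
          ext ν
          rw [ν.scott S hS hd, iSup_subtype']
        rw [h1, integral_iSup _ _ fun U => lsc_eval _, iSup_subtype']
        rintro ⟨U, hU⟩ ⟨V, hV⟩
        obtain ⟨W, hW, hUW, hVW⟩ := hd U hU V hV
        exact ⟨⟨W, hW⟩, fun ν => ν.mono _ _ hUW, fun ν => ν.mono _ _ hVW⟩ }
  continuous_toFun := continuous_of_eval fun U => lsc_integral (lsc_eval U)

theorem mult_apply (ξ : Val (Val X)) (U : Opens X) : mult ξ U = ξ.integral fun ν => ν U := rfl

theorem ext_apply {ν ρ : Val X} (h : ∀ U, ν U = ρ U) : ν = ρ := Val.ext (funext h)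

theorem integral_map (f : C(X, Y)) (ν : Val X) {g : Y → ℝ≥0∞} (hg : LowerSemicontinuous g) :
    (map f ν).integral g = ν.integral (g ∘ f) := by
  symm
  refine functional_eq (map f ν) (fun g => ν.integral (g ∘ f)) ?_ ?_ ?_ hg
  · exact fun g h hg hh => ν.integral_add (hg.comp f.continuous) (hh.comp f.continuous)
  · intro h hm hl
    exact ν.integral_iSup (fun n => h n ∘ f) (fun n => (hl n).comp f.continuous)
      (Monotone.directed_le fun m n hmn x => hm hmn (f x))
  · intro U
    rw [map_apply, ← integral_indicator]
    rfl

theorem integral_dirac (x : X) {g : X → ℝ≥0∞} (hg : LowerSemicontinuous g) :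
    (dirac x).integral g = g x :=
  (functional_eq (dirac x) (fun g => g x) (fun _ _ _ _ => rfl) (fun _ _ _ => rfl)
    (fun _ => rfl) hg).symm

/-- The defining property of the multiplication on all lower semicontinuous functions. -/
theorem integral_mult (ξ : Val (Val X)) {g : X → ℝ≥0∞} (hg : LowerSemicontinuous g) :
    (mult ξ).integral g = ξ.integral fun ν => ν.integral g := by
  symm
  refine functional_eq (mult ξ) (fun g => ξ.integral fun ν => ν.integral g) ?_ ?_ ?_ hg
  · intro g h hg hh
    rw [← integral_add _ (lsc_integral hg) (lsc_integral hh)]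
    congr 1
    ext ν
    exact ν.integral_add hg hh
  · intro h hm hl
    rw [← integral_iSup _ _ (fun n => lsc_integral (hl n))
      (Monotone.directed_le fun m n hmn ν => ν.integral_mono (hm hmn))]
    congr 1
    ext ν
    exact ν.integral_iSup _ hl hm.directed_le
  · intro U
    simp_rw [integral_indicator]
    rfl

variable {Z : Type u} [TopologicalSpace Z]

theorem map_id (ν : Val X) : map (ContinuousMap.id X) ν = ν := rfl

theorem map_comp (f : C(X, Y)) (g : C(Y, Z)) (ν : Val X) :
    map (g.comp f) ν = map g (map f ν) := rfl

theorem map_dirac (f : C(X, Y)) (x : X) : dirac (f x) = map f (dirac x) := rfl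

theorem map_mult (f : C(X, Y)) (ξ : Val (Val X)) : mult (map (map f) ξ) = map f (mult ξ) :=
  ext_apply fun U => by rw [mult_apply, integral_map _ _ (lsc_eval U)]; rfl

theorem mult_assoc (ξ : Val (Val (Val X))) : mult (map mult ξ) = mult (mult ξ) :=
  ext_apply fun U => by
    rw [mult_apply, mult_apply, integral_map _ _ (lsc_eval U), integral_mult _ (lsc_eval U)]
    rfl

theorem mult_dirac (ν : Val X) : mult (dirac ν) = ν :=
  ext_apply fun U => by rw [mult_apply, integral_dirac _ (lsc_eval U)]

theorem mult_map_dirac (ν : Val X) : mult (map dirac ν) = ν :=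
  ext_apply fun U => by
    rw [mult_apply, integral_map _ _ (lsc_eval U)]
    exact ν.integral_indicator U

end Val

/-- The valuation monad `V` on topological spaces. -/
noncomputable def valuationMonad : Monad TopCat.{u} where
  obj X := TopCat.of (Val X)
  map f := TopCat.ofHom (Val.map f.hom)
  map_id _ := TopCat.hom_ext <| ContinuousMap.ext Val.map_id
  map_comp f g := TopCat.hom_ext <| ContinuousMap.ext <| Val.map_comp f.hom g.hom
  η :=
    { app := fun _ => TopCat.ofHom Val.dirac
      naturality := fun _ _ f => TopCat.hom_ext <| ContinuousMap.ext <| Val.map_dirac f.hom }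
  μ :=
    { app := fun _ => TopCat.ofHom Val.mult
      naturality := fun _ _ f => TopCat.hom_ext <| ContinuousMap.ext <| Val.map_mult f.hom }
  assoc _ := TopCat.hom_ext <| ContinuousMap.ext Val.mult_assoc
  left_unit _ := TopCat.hom_ext <| ContinuousMap.ext Val.mult_dirac
  right_unit _ := TopCat.hom_ext <| ContinuousMap.ext Val.mult_map_dirac

/-! ### The monad of `τ`-smooth Borel probability measures -/

/-- A `τ`-smooth Borel probability measure on `X`. -/
structure TauProb (X : Type u) [TopologicalSpace X] : Type u where
  measure : @Measure X (borel X)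
  isProb : measure Set.univ = 1
  tauSmooth : ∀ S : Set (Opens X), S.Nonempty → DirectedOn (· ≤ ·) S →
    measure ((sSup S : Opens X) : Set X) = ⨆ U ∈ S, measure (U : Set X)

namespace TauProb

variable {X : Type u} [TopologicalSpace X] {Y : Type u} [TopologicalSpace Y]

/-- The restriction of a measure to the open sets. -/
def toVal (p : TauProb X) : Val X where
  toFun U := p.measure (U : Set X)
  map_bot := by simp
  mono _ _ h := measure_mono h
  modular U V := by
    letI : MeasurableSpace X := borel X
    haveI : BorelSpace X := ⟨rfl⟩
    exact measure_union_add_inter _ V.isOpen.measurableSet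
  scott := p.tauSmooth

/-- The topology induced from the space of continuous valuations, i.e. generated by the sets
`{p | r < p U}`. -/
instance : TopologicalSpace (TauProb X) := TopologicalSpace.induced toVal inferInstance

theorem toVal_apply (p : TauProb X) (U : Opens X) : p.toVal U = p.measure (U : Set X) := rfl

theorem toVal_injective : Function.Injective (toVal : TauProb X → Val X) := by
  intro p q h
  letI : MeasurableSpace X := borel X
  haveI : BorelSpace X := ⟨rfl⟩
  have : IsFiniteMeasure p.measure := ⟨by rw [p.isProb]; simp⟩
  have hm : p.measure = q.measure := by
    refine ext_of_generate_finite {s | IsOpen s} rfl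
      isPiSystem_isOpen ?_ (by rw [p.isProb, q.isProb])
    intro s hs
    exact congrArg (fun ν : Val X => ν ⟨s, hs⟩) h
  cases p; cases q; simp_all

/-- The inclusion of `P X` into `V X`. -/
def incl : C(TauProb X, Val X) := ⟨toVal, continuous_induced_dom⟩

theorem lintegral_eq (p : TauProb X) {g : X → ℝ≥0∞} (hg : LowerSemicontinuous g) :
    @lintegral X (borel X) p.measure g = p.toVal.integral g := by
  letI : MeasurableSpace X := borel X
  haveI : BorelSpace X := ⟨rfl⟩
  refine Val.functional_eq p.toVal (fun g => ∫⁻ x, g x ∂p.measure) ?_ ?_ ?_ hg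
  · exact fun f g hf _ => lintegral_add_left hf.measurable _
  · exact fun f hm hl => lintegral_iSup (fun n => (hl n).measurable) hm
  · exact fun U => lintegral_indicator_one U.isOpen.measurableSet

/-- The pushforward of measures. -/
noncomputable def map (f : C(X, Y)) : C(TauProb X, TauProb Y) where
  toFun p :=
    letI : MeasurableSpace X := borel X
    haveI : BorelSpace X := ⟨rfl⟩
    letI : MeasurableSpace Y := borel Y
    haveI : BorelSpace Y := ⟨rfl⟩
    have h : ∀ U : Opens Y, p.measure.map f (U : Set Y) = Val.map f p.toVal U := fun U =>
      Measure.map_apply f.continuous.measurable U.isOpen.measurableSet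
    { measure := p.measure.map f
      isProb := by
        rw [Measure.map_apply f.continuous.measurable MeasurableSet.univ]; exact p.isProb
      tauSmooth := fun S hS hd => by
        simp_rw [h]; exact (Val.map f p.toVal).scott S hS hd }
  continuous_toFun := by
    refine continuous_induced_rng.2 ?_
    convert (Val.map f).continuous.comp (incl (X := X)).continuous using 1
    ext p U
    letI : MeasurableSpace X := borel X
    haveI : BorelSpace X := ⟨rfl⟩
    letI : MeasurableSpace Y := borel Y
    haveI : BorelSpace Y := ⟨rfl⟩
    exact Measure.map_apply f.continuous.measurable U.isOpen.measurableSet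

theorem incl_map (f : C(X, Y)) (p : TauProb X) : incl (map f p) = Val.map f (incl p) := by
  ext U
  letI : MeasurableSpace X := borel X
  haveI : BorelSpace X := ⟨rfl⟩
  letI : MeasurableSpace Y := borel Y
  haveI : BorelSpace Y := ⟨rfl⟩
  exact Measure.map_apply f.continuous.measurable U.isOpen.measurableSet

theorem dirac_apply (x : X) (U : Opens X) :
    @Measure.dirac X (borel X) x (U : Set X) = Val.dirac x U := by
  letI : MeasurableSpace X := borel X
  haveI : BorelSpace X := ⟨rfl⟩
  exact Measure.dirac_apply' x U.isOpen.measurableSet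

/-- The Dirac measure. -/
noncomputable def dirac : C(X, TauProb X) where
  toFun x :=
    { measure := @Measure.dirac X (borel X) x
      isProb := by
        letI : MeasurableSpace X := borel X
        exact measure_univ
      tauSmooth := fun S hS hd => by
        simp_rw [dirac_apply]; exact (Val.dirac x).scott S hS hd }
  continuous_toFun := by
    refine continuous_induced_rng.2 ?_
    convert (Val.dirac (X := X)).continuous using 1
    ext x U
    exact dirac_apply x U

theorem incl_dirac (x : X) : incl (dirac x) = Val.dirac x := by
  ext U
  exact dirac_apply x U

theorem lsc_eval (U : Opens X) : LowerSemicontinuous fun p : TauProb X => p.measure (U : Set X) :=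
  (Val.lsc_eval U).comp (incl (X := X)).continuous

theorem measurable_measure :
    @Measurable (TauProb X) (@Measure X (borel X)) (borel _)
      (@Measure.instMeasurableSpace X (borel X)) TauProb.measure := by
  letI : MeasurableSpace X := borel X
  haveI : BorelSpace X := ⟨rfl⟩
  letI : MeasurableSpace (TauProb X) := borel _
  haveI : BorelSpace (TauProb X) := ⟨rfl⟩
  have (p : TauProb X) : IsProbabilityMeasure p.measure := ⟨p.isProb⟩
  refine Measurable.measure_of_isPiSystem_of_isProbabilityMeasure (S := {s | IsOpen s})
    rfl isPiSystem_isOpen ?_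
  exact fun s hs => (lsc_eval ⟨s, hs⟩).measurable

/-- The average `(E μ)(A) = ∫ p(A) dμ(p)` of a measure on measures. -/
noncomputable def avg (μ : TauProb (TauProb X)) : @Measure X (borel X) :=
  @Measure.bind (TauProb X) X (borel _) (borel X) μ.measure TauProb.measure

theorem avg_apply (μ : TauProb (TauProb X)) {A : Set X} (hA : @MeasurableSet X (borel X) A) :
    avg μ A = @lintegral (TauProb X) (borel _) μ.measure fun p => p.measure A := by
  letI : MeasurableSpace X := borel X
  letI : MeasurableSpace (TauProb X) := borel _
  exact Measure.bind_apply hA measurable_measure.aemeasurable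

theorem avg_open (μ : TauProb (TauProb X)) (U : Opens X) :
    avg μ (U : Set X) = Val.mult (Val.map incl (incl μ)) U := by
  letI : MeasurableSpace X := borel X
  haveI : BorelSpace X := ⟨rfl⟩
  rw [avg_apply μ U.isOpen.measurableSet, lintegral_eq μ (lsc_eval U), Val.mult_apply,
    Val.integral_map _ _ (Val.lsc_eval U)]
  rfl

/-- The multiplication `(E μ)(A) = ∫ p(A) dμ(p)`. -/
noncomputable def mult : C(TauProb (TauProb X), TauProb X) where
  toFun μ :=
    { measure := avg μ
      isProb := by
        letI : MeasurableSpace X := borel X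
        letI : MeasurableSpace (TauProb X) := borel _
        rw [avg_apply μ MeasurableSet.univ]
        simp [TauProb.isProb]
      tauSmooth := fun S hS hd => by
        simp_rw [avg_open]; exact (Val.mult (Val.map incl (incl μ))).scott S hS hd }
  continuous_toFun := by
    refine continuous_induced_rng.2 ?_
    convert (Val.mult (X := X)).continuous.comp
      ((Val.map (incl (X := X))).continuous.comp (incl (X := TauProb X)).continuous) using 1
    ext μ U
    exact avg_open μ U

theorem incl_mult (μ : TauProb (TauProb X)) :
    incl (mult μ) = Val.mult (Val.map incl (incl μ)) := by
  ext U
  exact avg_open μ U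

theorem incl_injective {p q : TauProb X} (h : incl p = incl q) : p = q := toVal_injective h

variable {Z : Type u} [TopologicalSpace Z]

theorem map_id (p : TauProb X) : map (ContinuousMap.id X) p = p :=
  incl_injective (incl_map _ p)

theorem map_comp (f : C(X, Y)) (g : C(Y, Z)) (p : TauProb X) :
    map (g.comp f) p = map g (map f p) :=
  incl_injective <| by rw [incl_map, incl_map, incl_map, Val.map_comp]

theorem map_dirac (f : C(X, Y)) (x : X) : dirac (f x) = map f (dirac x) :=
  incl_injective <| by rw [incl_map, incl_dirac, incl_dirac, Val.map_dirac]

theorem map_mult (f : C(X, Y)) (μ : TauProb (TauProb X)) :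
    mult (map (map f) μ) = map f (mult μ) :=
  incl_injective <| by
    have : incl.comp (map f) = (Val.map f).comp incl := ContinuousMap.ext (incl_map f)
    rw [incl_mult, incl_map, incl_map, incl_mult, ← Val.map_comp, this, Val.map_comp,
      Val.map_mult]

theorem mult_assoc (μ : TauProb (TauProb (TauProb X))) : mult (map mult μ) = mult (mult μ) :=
  incl_injective <| by
    have : incl.comp mult = (Val.mult (X := X)).comp ((Val.map incl).comp incl) :=
      ContinuousMap.ext incl_mult
    rw [incl_mult, incl_map, incl_mult, incl_mult, ← Val.map_comp, this, Val.map_comp,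
      Val.map_comp, Val.mult_assoc, Val.map_mult]

theorem mult_dirac (p : TauProb X) : mult (dirac p) = p :=
  incl_injective <| by rw [incl_mult, incl_dirac, ← Val.map_dirac, Val.mult_dirac]

theorem mult_map_dirac (p : TauProb X) : mult (map dirac p) = p :=
  incl_injective <| by
    have : incl.comp dirac = Val.dirac (X := X) := ContinuousMap.ext incl_dirac
    rw [incl_mult, incl_map, ← Val.map_comp, this, Val.mult_map_dirac]

end TauProb

/-- The monad `P` of `τ`-smooth Borel probability measures on topological spaces. -/
noncomputable def probabilityMonad : Monad TopCat.{u} where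
  obj X := TopCat.of (TauProb X)
  map f := TopCat.ofHom (TauProb.map f.hom)
  map_id _ := TopCat.hom_ext <| ContinuousMap.ext TauProb.map_id
  map_comp f g := TopCat.hom_ext <| ContinuousMap.ext <| TauProb.map_comp f.hom g.hom
  η :=
    { app := fun _ => TopCat.ofHom TauProb.dirac
      naturality := fun _ _ f => TopCat.hom_ext <| ContinuousMap.ext <| TauProb.map_dirac f.hom }
  μ :=
    { app := fun _ => TopCat.ofHom TauProb.mult
      naturality := fun _ _ f => TopCat.hom_ext <| ContinuousMap.ext <| TauProb.map_mult f.hom }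
  assoc _ := TopCat.hom_ext <| ContinuousMap.ext TauProb.mult_assoc
  left_unit _ := TopCat.hom_ext <| ContinuousMap.ext TauProb.mult_dirac
  right_unit _ := TopCat.hom_ext <| ContinuousMap.ext TauProb.mult_map_dirac

/-! ### The support -/

variable {X : Type u} [TopologicalSpace X]

/-- The support of a continuous valuation: the complement of the union of all open null sets. -/
def supp (ν : Val X) : Hyp X where
  carrier := ((sSup {U : Opens X | ν U = 0} : Opens X) : Set X)ᶜ
  closed := (Opens.isOpen _).isClosed_compl

/-- The support hits exactly the open sets of positive value. -/
theorem hits_supp (ν : Val X) (U : Opens X) : (supp ν).Hits U ↔ 0 < ν U := by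
  have hnull : ν (sSup {U : Opens X | ν U = 0}) = 0 := by
    rw [ν.scott _ ⟨⊥, ν.map_bot⟩]
    · simp
    · intro U hU V hV
      refine ⟨U ⊔ V, ?_, le_sup_left, le_sup_right⟩
      have h := ν.modular U V
      rw [show ν U = 0 from hU, show ν V = 0 from hV, add_zero] at h
      exact (add_eq_zero.1 h).1
  constructor
  · rintro ⟨x, hx, hxU⟩
    refine pos_iff_ne_zero.2 fun h => hx ?_
    exact (show U ≤ sSup {U : Opens X | ν U = 0} from le_sSup h) hxU
  · intro h
    by_contra hU
    refine h.ne' (le_antisymm ?_ bot_le)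
    rw [← hnull]
    refine ν.mono _ _ fun x hx => ?_
    by_contra hx'
    exact hU ⟨x, hx', hx⟩

/-- The support as a continuous map `V X → H X`. -/
def suppMap (X : Type u) [TopologicalSpace X] : C(Val X, Hyp X) where
  toFun := supp
  continuous_toFun := Hyp.continuous_of_hits fun U => by
    simp_rw [hits_supp]
    simpa using Val.isOpen_lt U 0

/-- The support as a morphism `V X ⟶ H X` of topological spaces. -/
def suppHom (X : TopCat.{u}) : valuationMonad.obj X ⟶ hyperspaceMonad.obj X :=
  TopCat.ofHom (suppMap X)

/-- The inclusion of measures into valuations as a morphism `P X ⟶ V X` of topological spaces. -/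
def inclHom (X : TopCat.{u}) : probabilityMonad.obj X ⟶ valuationMonad.obj X :=
  TopCat.ofHom TauProb.incl

/-! ### Algebras and topological complete join-semilattices -/

/-- `a : T A ⟶ A` is the structure map of an (Eilenberg–Moore) `T`-algebra on `A`. -/
def IsAlgebra {C : Type*} [Category C] (T : Monad C) {A : C} (a : T.obj A ⟶ A) : Prop :=
  T.η.app A ≫ a = 𝟙 A ∧ T.μ.app A ≫ a = T.map a ≫ a

/-- A complete lattice with a sober topology whose specialization preorder (`x ≤ y` iff `x` lies in
the closure of `y`) is the lattice order and whose binary join is continuous. -/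
structure IsTopCompleteJoinSemilattice (L : Type u) [CompleteLattice L] [TopologicalSpace L] :
    Prop where
  t0 : T0Space L
  quasiSober : QuasiSober L
  le_iff_mem_closure : ∀ x y : L, x ≤ y ↔ x ∈ closure {y}
  continuous_sup : Continuous fun p : L × L => p.1 ⊔ p.2

end HypVal

namespace HypVal

/-! ### The support and the inclusion as morphisms of monads -/

/-! ### Vanishing of the lower integral. -/

namespace Val

variable {X : Type u} [TopologicalSpace X]

/-! A closed set is determined by the open sets it hits, and the support of `ν` hits `U` exactly
when `ν U > 0`. Every identity required of the support is therefore a statement about positivity on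
open sets. Naturality and the unit law are immediate. The multiplication law says that `∫ ν(U)
dξ(ν)` is positive iff `ξ` is positive on the open set of those `ν` with `ν U > 0`. This is
`integral_eq_zero_iff`: a lower integral vanishes iff the valuation vanishes on the set where the
integrand is positive, which follows from Chebyshev's inequality and Scott continuity.

The inclusion of measures needs no new work: `TauProb.incl_map`, `TauProb.incl_dirac` and
`TauProb.incl_mult` are its naturality and, up to naturality in the last case, its unit and
multiplication laws. Algebras pull back along morphisms of monads by naturality
(`IsAlgebra.comp_app`), which settles the abstract part.

For a topological complete join-semilattice it then suffices that the join of closed sets is an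
`H`-algebra. The algebra laws hold because a set and its closure have the same upper bounds,
principal lower sets being closed. Continuity combines two facts. By sobriety a directed set
converges to its supremum, so if the join of `S` lies in an open set then so does the join of some
finite subset of `S`. By continuity of the binary join, this finite witness can be perturbed, so
that it persists for all closed sets near the given one. -/

theorem above_anti {g : X → ℝ≥0∞} (hg : LowerSemicontinuous g) {a b : ℝ≥0∞} (h : a ≤ b) :
    above g b ≤ above g a := fun _ hx =>
  (mem_above hg).2 (h.trans_lt ((mem_above hg).1 hx))

theorem mass_eq_zero (ν : Val X) {s : List (Opens X)} (h : ∀ U ∈ s, ν U = 0) : ν.mass s = 0 := by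
  induction s with
  | nil => simp [mass]
  | cons U s ih => rw [mass_cons, h U (by simp), ih fun V hV => h V (by simp [hV]), add_zero]

/-- Countable additivity is replaced by Scott continuity: the set where `g` is positive is a
directed union of sets on which `g` is bounded below by a positive constant. This is the analytic
content of the multiplication law for the support. -/
theorem integral_eq_zero_iff (ν : Val X) {g : X → ℝ≥0∞} (hg : LowerSemicontinuous g) :
    ν.integral g = 0 ↔ ν (above g 0) = 0 := by
  constructor
  · intro h
    -- Any sequence of positive numbers decreasing to zero would serve; powers of one half exhaust
    -- the set where `g` is positive by an increasing sequence.
    have hsup : above g 0 = sSup (Set.range fun n : ℕ => above g (2⁻¹ ^ n)) := by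
      ext x
      rw [SetLike.mem_coe, SetLike.mem_coe, mem_above hg, Opens.mem_sSup]
      simp only [Set.exists_range_iff, mem_above hg]
      constructor
      · intro hx
        exact ((ENNReal.tendsto_pow_atTop_nhds_zero_of_lt_one (r := (2⁻¹ : ℝ≥0∞))
          (by norm_num)).eventually_lt_const hx).exists
      · rintro ⟨n, hn⟩
        exact bot_le.trans_lt hn
    have hanti : Antitone fun n : ℕ => (2⁻¹ : ℝ≥0∞) ^ n := fun m n hmn =>
      pow_le_pow_right_of_le_one' (by norm_num) hmn
    rw [hsup, ν.scott _ (Set.range_nonempty _), iSup_range]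
    · refine ENNReal.iSup_eq_zero.2 fun n => ?_
      -- Chebyshev's inequality: `2⁻ⁿ` times the indicator of the set where `g > 2⁻ⁿ` lies below
      -- `g`. As the integral is zero and the coefficient is not, the set is null.
      have hle := ν.le_integral (g := g) (2⁻¹ ^ n) [above g (2⁻¹ ^ n)] fun x => by
        by_cases hx : x ∈ above g (2⁻¹ ^ n)
        · simpa [cnt, hx] using ((mem_above hg).1 hx).le
        · simp [cnt, hx]
      rw [h, nonpos_iff_eq_zero, mul_eq_zero] at hle
      simpa [mass] using hle
    · rintro _ ⟨m, rfl⟩ _ ⟨n, rfl⟩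
      exact ⟨_, ⟨max m n, rfl⟩, above_anti hg (hanti (le_max_left m n)),
        above_anti hg (hanti (le_max_right m n))⟩
  · intro h
    -- Every dyadic layer is a set where `g` exceeds some threshold, hence is contained in the null
    -- set where `g` is positive.
    rw [integral_eq_iSup ν hg]
    refine ENNReal.iSup_eq_zero.2 fun p => ?_
    rw [ν.mass_eq_zero, ENNReal.zero_div]
    intro U hU
    obtain ⟨k, -, rfl⟩ := List.mem_map.1 hU
    exact le_antisymm ((ν.mono _ _ (above_anti hg bot_le)).trans h.le) bot_le

end Val

/-! ### Compatibility of the support with the monad structures. -/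

section Morphisms

variable {X : Type u} [TopologicalSpace X] {Y : Type u} [TopologicalSpace Y]

theorem supp_map (f : C(X, Y)) (ν : Val X) : supp (Val.map f ν) = Hyp.map f (supp ν) :=
  Hyp.ext_hits fun U => by rw [hits_supp, Hyp.hits_map, hits_supp]; rfl

theorem supp_dirac (x : X) : supp (Val.dirac x) = Hyp.unit x :=
  Hyp.ext_hits fun U => by
    rw [hits_supp, Hyp.hits_unit, Val.dirac_apply]
    by_cases h : x ∈ U <;> simp [h]

/-- Hitting `U` means positivity of the integral of `ν ↦ ν U` on the left, and positivity of `ξ` on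
the set where this function is positive on the right. The zero criterion for the lower integral
identifies the two. -/
theorem supp_mult (ξ : Val (Val X)) :
    supp (Val.mult ξ) = Hyp.mult (supp (Val.map (suppMap X) ξ)) :=
  Hyp.ext_hits fun U => by
    have h : (Hyp.hitOpen U).comap (suppMap X) = Val.above (fun ν : Val X => ν U) 0 := by
      ext ν
      exact (hits_supp ν U).trans (Val.mem_above (Val.lsc_eval U)).symm
    rw [hits_supp, Hyp.hits_mult, hits_supp, Val.map_apply, h, pos_iff_ne_zero, pos_iff_ne_zero,
      Val.mult_apply, Ne, Val.integral_eq_zero_iff _ (Val.lsc_eval U)]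

end Morphisms

/-- The support as a morphism of monads. -/
def suppMonadHom : valuationMonad.{u} ⟶ hyperspaceMonad.{u} where
  app := suppHom
  naturality _ _ f := TopCat.hom_ext <| ContinuousMap.ext <| supp_map f.hom
  app_η _ := TopCat.hom_ext <| ContinuousMap.ext supp_dirac
  app_μ _ := TopCat.hom_ext <| ContinuousMap.ext supp_mult

/-- The inclusion of measures into valuations as a morphism of monads. -/
def inclMonadHom : probabilityMonad.{u} ⟶ valuationMonad.{u} where
  app := inclHom
  naturality _ _ f := TopCat.hom_ext <| ContinuousMap.ext <| TauProb.incl_map f.hom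
  app_η _ := TopCat.hom_ext <| ContinuousMap.ext TauProb.incl_dirac
  -- The monad morphism law applies the inclusion after `P` of the inclusion, whereas `incl_mult`
  -- applies it before `V` of the inclusion; naturality at the inclusion itself exchanges the two
  -- orders.
  app_μ _ := TopCat.hom_ext <| ContinuousMap.ext fun μ =>
    (TauProb.incl_mult μ).trans <| congrArg Val.mult (TauProb.incl_map TauProb.incl μ).symm

/-- Algebras pull back along morphisms of monads. -/
theorem IsAlgebra.comp_app {C : Type*} [Category C] {S T : Monad C} (f : S ⟶ T) {A : C}
    {a : T.obj A ⟶ A} (h : IsAlgebra T a) : IsAlgebra S (f.app A ≫ a) := by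
  have hη : S.η.app A ≫ f.app A = T.η.app A := MonadHom.app_η f A
  have hμ : S.μ.app A ≫ f.app A = (S.map (f.app A) ≫ f.app (T.obj A)) ≫ T.μ.app A :=
    MonadHom.app_μ f A
  have hnat : S.map a ≫ f.app A = f.app (T.obj A) ≫ T.map a := f.naturality a
  constructor
  · rw [← Category.assoc, hη, h.1]
  -- Naturality of `f` at `a` brings both sides to the composite of `S.map (f.app A)`, `f.app (T.obj
  -- A)`, `T.map a` and `a`.
  · rw [← Category.assoc, hμ, Category.assoc, h.2, Functor.map_comp, Category.assoc,
      Category.assoc, ← Category.assoc (S.map a), hnat, Category.assoc]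

/-! ### Topological complete join-semilattices as algebras -/

namespace IsTopCompleteJoinSemilattice

variable {L : Type u} [CompleteLattice L] [TopologicalSpace L]

/-! ### Order and topology of a topological complete join-semilattice. -/

theorem closure_singleton (hL : IsTopCompleteJoinSemilattice L) (b : L) :
    closure {b} = Set.Iic b :=
  Set.ext fun x => (hL.le_iff_mem_closure x b).symm

theorem isClosed_Iic (hL : IsTopCompleteJoinSemilattice L) (b : L) : IsClosed (Set.Iic b) :=
  hL.closure_singleton b ▸ isClosed_closure

theorem isUpperSet (hL : IsTopCompleteJoinSemilattice L) {U : Set L} (hU : IsOpen U) :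
    IsUpperSet U := fun x y hxy hx => by
  obtain ⟨_, hz, rfl⟩ := mem_closure_iff.1 ((hL.le_iff_mem_closure x y).1 hxy) U hU hx
  exact hz

/-- The closed set `Set.Iic (sSup S)` contains `S`, hence its closure. This removes the closures
built into the unit, direct images and multiplication of `H` from the algebra laws. -/
theorem sSup_closure (hL : IsTopCompleteJoinSemilattice L) (S : Set L) :
    sSup (closure S) = sSup S :=
  le_antisymm
    (sSup_le fun _ hx => closure_minimal (fun _ hy => le_sSup hy) (hL.isClosed_Iic (sSup S)) hx)
    (sSup_le_sSup subset_closure)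

/-- By sobriety, a directed set converges to its supremum. -/
theorem sSup_mem_closure (hL : IsTopCompleteJoinSemilattice L) {D : Set L} (hne : D.Nonempty)
    (hd : DirectedOn (· ≤ ·) D) : sSup D ∈ closure D := by
  -- Two open sets that meet `D` do so at points with a common upper bound in `D`, which lies in
  -- both because open sets are upper sets.
  have hirr : IsIrreducible D := by
    refine ⟨hne, fun U V hU hV => ?_⟩
    rintro ⟨x, hx, hxU⟩ ⟨y, hy, hyV⟩
    obtain ⟨z, hz, hxz, hyz⟩ := hd x hx y hy
    exact ⟨z, hz, hL.isUpperSet hU hxz hxU, hL.isUpperSet hV hyz hyV⟩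
  -- The generic point `x` of the irreducible closed set `closure D` is its greatest element, hence
  -- the supremum of `D`, and it belongs to the closure.
  obtain ⟨x, hx⟩ := hL.quasiSober.sober hirr.closure isClosed_closure
  have hx' : closure D = Set.Iic x := by rw [← hL.closure_singleton]; exact hx.symm
  have : sSup D = x := by rw [← hL.sSup_closure, hx', isLUB_Iic.sSup_eq]
  rw [this, hx']
  exact Set.mem_Iic.2 le_rfl

/-- The finite joins of elements of `S` form a directed set with supremum at least `sSup S`. This
set converges to its supremum, so it enters every open neighbourhood of it. -/
theorem exists_finset_sup_mem (hL : IsTopCompleteJoinSemilattice L) {U : Set L} (hU : IsOpen U)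
    {S : Set L} (hS : sSup S ∈ U) : ∃ F : Finset L, (F : Set L) ⊆ S ∧ F.sup id ∈ U := by
  set D : Set L := {x | ∃ F : Finset L, (F : Set L) ⊆ S ∧ F.sup id = x}
  have hd : DirectedOn (· ≤ ·) D := by
    classical
    rintro _ ⟨F, hF, rfl⟩ _ ⟨G, hG, rfl⟩
    exact ⟨(F ∪ G).sup id, ⟨F ∪ G, by simp [hF, hG], rfl⟩, Finset.sup_mono Finset.subset_union_left,
      Finset.sup_mono Finset.subset_union_right⟩
  have hle : sSup S ≤ sSup D := sSup_le fun x hx => le_sSup ⟨{x}, by simpa using hx, by simp⟩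
  -- The empty join `⊥` keeps the directed set nonempty even when `S` is empty, as it may be for a
  -- point of the hyperspace.
  have hne : D.Nonempty := ⟨⊥, ∅, by simp, by simp⟩
  obtain ⟨_, hx, F, hF, rfl⟩ := mem_closure_iff.1
    (hL.sSup_mem_closure hne hd) U hU (hL.isUpperSet hU hle hS)
  exact ⟨F, hF, hx⟩

/-! ### Continuity and algebra laws of the join on the hyperspace. -/

open Topology in
-- A closed set near `C` in the lower Vietoris topology hits a small neighbourhood of each of the
-- finitely many elements of `F`. By continuity of the binary join, the join of the points hit still
-- lies in `U`, and so does the larger join of the whole closed set. The induction varies `U` to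
-- split off one element at a time.
theorem sSup_carrier_mem_nhds (hL : IsTopCompleteJoinSemilattice L) (C : Hyp L) (F : Finset L)
    (hF : (F : Set L) ⊆ C.carrier) (U : Set L) (hU : IsOpen U) (h : F.sup id ∈ U) :
    {D : Hyp L | sSup D.carrier ∈ U} ∈ 𝓝 C := by
  classical
  induction F using Finset.induction_on generalizing U with
  -- Here `⊥` lies in the upper set `U`, so `U` is all of `L` and the condition is vacuous.
  | empty => exact Filter.univ_mem' fun D => hL.isUpperSet hU bot_le (by simpa using h)
  | insert a F _ ih =>
    rw [Finset.sup_insert] at h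
    rw [Finset.coe_insert, Set.insert_subset_iff] at hF
    obtain ⟨V, W, hV, hW, haV, hFW, hVW⟩ :=
      isOpen_prod_iff.1 (hU.preimage hL.continuous_sup) a (F.sup id) h
    filter_upwards [ih hF.2 W hW hFW,
      (Hyp.isOpen_hit (⟨V, hV⟩ : Opens L)).mem_nhds ⟨a, hF.1, haV⟩] with D hDW hDV
    obtain ⟨c, hc, hcV⟩ := hDV
    -- The point `c` belongs to `D`, so its join with `sSup D.carrier` is just `sSup D.carrier`.
    have hmem : c ⊔ sSup D.carrier ∈ U := hVW (Set.mk_mem_prod hcV hDW)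
    rwa [sup_eq_right.2 (le_sSup hc)] at hmem

/-- The join as a continuous map on the hyperspace. -/
def join (hL : IsTopCompleteJoinSemilattice L) : C(Hyp L, L) where
  toFun C := sSup C.carrier
  continuous_toFun := by
    refine ⟨fun U hU => isOpen_iff_mem_nhds.2 fun C hC => ?_⟩
    obtain ⟨F, hF, h⟩ := hL.exists_finset_sup_mem hU hC
    exact hL.sSup_carrier_mem_nhds C F hF U hU h

theorem join_unit (hL : IsTopCompleteJoinSemilattice L) (x : L) : hL.join (Hyp.unit x) = x :=
  (hL.sSup_closure {x}).trans sSup_singleton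

/-- Once the closures are dropped, this is associativity of arbitrary joins: the join of a union is
the join of the joins. -/
theorem join_mult (hL : IsTopCompleteJoinSemilattice L) (K : Hyp (Hyp L)) :
    hL.join (Hyp.mult K) = hL.join (Hyp.map hL.join K) := by
  change sSup (closure _) = sSup (closure _)
  rw [hL.sSup_closure, hL.sSup_closure, sSup_image]
  simp only [sSup_iUnion]
  rfl

theorem isAlgebra_join (hL : IsTopCompleteJoinSemilattice L) :
    IsAlgebra hyperspaceMonad (A := TopCat.of L) (TopCat.ofHom hL.join) :=
  ⟨TopCat.hom_ext <| ContinuousMap.ext hL.join_unit,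
    TopCat.hom_ext <| ContinuousMap.ext hL.join_mult⟩

end IsTopCompleteJoinSemilattice

end HypVal

theorem mainTheorem9 :
    ∃ (s : HypVal.valuationMonad.{u} ⟶ HypVal.hyperspaceMonad.{u})
      (i : HypVal.probabilityMonad.{u} ⟶ HypVal.valuationMonad.{u}),
      (∀ X : TopCat.{u}, s.app X = HypVal.suppHom X) ∧
      (∀ X : TopCat.{u}, i.app X = HypVal.inclHom X) ∧
      (∀ (A : TopCat.{u}) (a : HypVal.hyperspaceMonad.obj A ⟶ A),
        HypVal.IsAlgebra HypVal.hyperspaceMonad a →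
          HypVal.IsAlgebra HypVal.valuationMonad (s.app A ≫ a) ∧
          HypVal.IsAlgebra HypVal.probabilityMonad (i.app A ≫ s.app A ≫ a)) ∧
      (∀ (L : Type u) [CompleteLattice L] [TopologicalSpace L],
        HypVal.IsTopCompleteJoinSemilattice L →
          ∃ e : HypVal.valuationMonad.obj (TopCat.of L) ⟶ TopCat.of L,
            (∀ ν : HypVal.Val L, e.hom ν = sSup (HypVal.supp ν).carrier) ∧
            HypVal.IsAlgebra HypVal.valuationMonad e) := by
  refine ⟨HypVal.suppMonadHom, HypVal.inclMonadHom, fun _ => rfl, fun _ => rfl, ?_, ?_⟩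
  · exact fun A a ha => ⟨ha.comp_app _, (ha.comp_app _).comp_app _⟩
  -- The structure map is the support followed by the join, so its continuity is part of its being a
  -- morphism, and the algebra laws are pulled back from `H`.
  · exact fun L _ _ hL => ⟨HypVal.suppMonadHom.app (TopCat.of L) ≫ TopCat.ofHom hL.join,
      fun _ => rfl, hL.isAlgebra_join.comp_app _⟩
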